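/- Let $N=N(n)>n$ be integers, put $r=N/n$, let $\omega=\omega(n)\ge 2$ be real numbers (for instance $\omega=\omega(r)$ a function of $r$), and let $p=\frac{1}{\omega n}$. Assume that $p\ge 1/N$ (that is, $\omega\le r$) and that $4\log N\le n$ for all sufficiently large $n$. Let $G(N,p)$ be the binomial random graph on $N$ vertices with edge probability $p$, let $P_{n+1}$ be the path with $n+1$ vertices, and for graphs $G,F$ let $c(G,F)$ be the minimum number $k$ such that the edges of $G$ can be colored with $k$ colors without a monochromatic copy of $F$. Then $$\lim_{n\to\infty}\Pr\left[c(G(N,p),P_{n+1})\le \frac{2r}{\omega}\right]=1 .$$ -/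

import Mathlib

/-- `c(G, F)`: the minimum number `k` of colors such that the edges of `G` can be colored with `k`
colors without a monochromatic copy of `F` (no color class contains `F` as a subgraph, not
necessarily induced); it is `⊤` if no finite number of colors suffices. -/
noncomputable def SimpleGraph.avoidingColorNumber {V W : Type*}
    (G : SimpleGraph V) (F : SimpleGraph W) : ℕ∞ :=
  ⨅ k ∈ {k : ℕ | ∃ C : G.EdgeLabeling (Fin k), ∀ i, F.Free (C.labelGraph i)}, (k : ℕ∞)

/-! A first moment argument over graph and coloring. If `G` has `X` labelled copies of the path with
`n` edges, a uniform `k`-coloring has on average `X * k / k ^ n` monochromatic ones; below `1`, some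
coloring has none (`exists_edgeLabeling_free`). In `G(N, p)` the mean of `X` is at most `N ^ (n + 1)
* p ^ n`, so by Markov failure has probability at most `N * k * (d / k) ^ n`, where `d = N * p = r /
ω`. For `k = ⌊2 * d⌋₊` the ratio `d / k` is small enough that the power beats `N ≤ exp (n / 4)`
(`mul_pow_div_floor_le`). -/

open MeasureTheory ProbabilityTheory unitInterval Filter
open scoped ENNReal Topology

namespace SimpleGraph

/-! ### Colorings that avoid a graph with few copies -/

section Coloring

variable {V W : Type*}

/-- The number of functions that take the prescribed value `i` on a finite set `s`. -/
lemma card_filter_forall_mem_eq {E : Type*} [Fintype E] [DecidableEq E] {k : ℕ}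
    (s : Finset E) (i : Fin k) :
    (Finset.univ.filter fun C : E → Fin k => ∀ e ∈ s, C e = i).card * k ^ s.card =
      k ^ Fintype.card E := by
  have h : (Finset.univ.filter fun C : E → Fin k => ∀ e ∈ s, C e = i) =
      Fintype.piFinset fun e => if e ∈ s then {i} else Finset.univ := by
    ext C
    simp only [Finset.mem_filter, Finset.mem_univ, true_and, Fintype.mem_piFinset]
    refine forall_congr' fun e => ?_
    by_cases he : e ∈ s <;> simp [he]
  have h' : ∀ e, (if e ∈ s then {i} else Finset.univ : Finset (Fin k)).card =
      if e ∈ s then 1 else k := fun e => by split_ifs <;> simp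
  rw [h, Fintype.card_piFinset, Finset.prod_congr rfl fun e _ => h' e, Finset.prod_ite]
  simp only [Finset.prod_const_one, one_mul, Finset.prod_const]
  rw [← pow_add, ← Finset.card_univ, Finset.filter_not, Finset.filter_mem_eq_inter,
    Finset.univ_inter, Finset.card_sdiff_add_card_eq_card (Finset.subset_univ s)]

/-- A copy of `F` in a color class is a copy of `F` in `G` all of whose edges have that color. -/
lemma exists_copy_of_not_free_labelGraph {G : SimpleGraph V} {F : SimpleGraph W} {K : Type*}
    (C : G.EdgeLabeling K) (i : K) (h : ¬ F.Free (C.labelGraph i)) :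
    ∃ f : Copy F G, ∀ e, C (f.mapEdgeSet e) = i := by
  obtain ⟨g⟩ := not_free.mp h
  have hadj : ∀ {a b}, F.Adj a b → ∃ h : G.Adj (g a) (g b), C ⟨s(g a, g b), h⟩ = i := by
    intro a b hab
    have := g.toHom.map_adj hab
    simp only [EdgeLabeling.labelGraph, fromEdgeSet_adj] at this
    exact this.1
  refine ⟨⟨⟨g, fun hab => (hadj hab).1⟩, g.injective⟩, ?_⟩
  rintro ⟨e, he⟩
  induction e using Sym2.inductionOn with
  | _ a b => exact (hadj he).2

/-- If `G` has few labelled copies of `F`, then averaging over all colorings with `k` colors yields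
one without a monochromatic copy of `F`. -/
lemma exists_edgeLabeling_free [Fintype V] [Fintype W] (G : SimpleGraph V) (F : SimpleGraph W)
    {k : ℕ} (hk : 0 < k) (h : G.labelledCopyCount F * k < k ^ F.edgeSet.ncard) :
    ∃ C : G.EdgeLabeling (Fin k), ∀ i, F.Free (C.labelGraph i) := by
  classical
  by_contra! hbad
  have key : ∀ C : G.edgeSet → Fin k, ∃ x : Copy F G × Fin k,
      ∀ e ∈ Finset.univ.image x.1.mapEdgeSet, C e = x.2 := by
    intro C
    obtain ⟨i, hi⟩ := hbad C
    obtain ⟨f, hf⟩ := exists_copy_of_not_free_labelGraph (G := G) C i (not_not.mpr hi)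
    refine ⟨(f, i), fun e he => ?_⟩
    obtain ⟨e, -, rfl⟩ := Finset.mem_image.mp he
    exact hf e
  -- Union bound: these sets, one per copy and color, would cover all colorings, yet each is only a
  -- fraction `k ^ (-e(F))` of them.
  have hcov : (Finset.univ : Finset (G.edgeSet → Fin k)) ⊆
      Finset.univ.biUnion fun x : Copy F G × Fin k =>
        Finset.univ.filter fun C => ∀ e ∈ Finset.univ.image x.1.mapEdgeSet, C e = x.2 := by
    intro C _
    simpa using key C
  have hcard : ∀ x : Copy F G × Fin k,
      (Finset.univ.filter fun C : G.edgeSet → Fin k =>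
        ∀ e ∈ Finset.univ.image x.1.mapEdgeSet, C e = x.2).card * k ^ F.edgeSet.ncard =
      k ^ Fintype.card G.edgeSet := by
    intro x
    have := card_filter_forall_mem_eq (Finset.univ.image x.1.mapEdgeSet) x.2
    rwa [Finset.card_image_of_injective _ x.1.mapEdgeSet.injective, Finset.card_univ,
      ← Nat.card_eq_fintype_card, Nat.card_coe_set_eq] at this
  have hle := Nat.mul_le_mul_right (k ^ F.edgeSet.ncard)
    ((Finset.card_le_card hcov).trans Finset.card_biUnion_le)
  rw [Finset.sum_mul, Finset.sum_congr rfl fun x _ => hcard x] at hle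
  simp only [Finset.card_univ, Fintype.card_fun, Fintype.card_fin, Finset.sum_const,
    Fintype.card_prod, smul_eq_mul] at hle
  rw [mul_comm] at hle
  have := Nat.le_of_mul_le_mul_right hle (pow_pos hk _)
  exact absurd this (not_le.mpr h)

lemma avoidingColorNumber_le {G : SimpleGraph V} {F : SimpleGraph W} {k : ℕ}
    (C : G.EdgeLabeling (Fin k)) (hC : ∀ i, F.Free (C.labelGraph i)) :
    G.avoidingColorNumber F ≤ k :=
  iInf₂_le k ⟨C, hC⟩

lemma ncard_edgeSet_pathGraph (n : ℕ) : (pathGraph (n + 1)).edgeSet.ncard = n := by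
  have h : (pathGraph (n + 1)).edgeSet =
      Set.range fun i : Fin n => s(i.castSucc, i.succ) := by
    ext e
    induction e using Sym2.inductionOn with
    | _ a b =>
      simp only [mem_edgeSet, pathGraph_adj, Set.mem_range, Sym2.eq_iff, Fin.ext_iff,
        Fin.val_castSucc, Fin.val_succ]
      constructor
      · rintro (h | h)
        · exact ⟨⟨a, by omega⟩, .inl ⟨rfl, h⟩⟩
        · exact ⟨⟨b, by omega⟩, .inr ⟨rfl, h⟩⟩
      · rintro ⟨i, h⟩
        omega
  rw [h, ← Set.image_univ, Set.ncard_image_of_injective, Set.ncard_univ, Nat.card_fin]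
  intro i j hij
  simp only [Sym2.eq_iff, Fin.ext_iff, Fin.val_castSucc, Fin.val_succ] at hij
  ext
  omega

end Coloring

/-! ### Copies in the binomial random graph -/

section Random

variable {V W : Type*}

lemma measurableSet_setOf_le [Finite V] (H : SimpleGraph V) :
    MeasurableSet {G : SimpleGraph V | H ≤ G} := by
  have : {G : SimpleGraph V | H ≤ G} = edgeSet ⁻¹' {S | H.edgeSet ⊆ S} := by
    ext; simp
  rw [this]
  exact measurable_edgeSet .of_discrete

/-- The binomial random graph contains a given graph `H` with probability `p ^ e(H)`. -/
lemma binomialRandom_setOf_le [Finite V] (p : I) (H : SimpleGraph V) :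
    binomialRandom V p {G | H ≤ G} = (toNNReal p : ℝ≥0∞) ^ H.edgeSet.ncard := by
  classical
  cases nonempty_fintype V
  rw [binomialRandom_eq_map, Measure.map_apply measurable_fromEdgeSet (measurableSet_setOf_le H),
     setBernoulli_apply']
  have hset : (fun q : Sym2 V → Prop => {e | q e}) ⁻¹' (fromEdgeSet ⁻¹' {G | H ≤ G}) =
      Set.pi (H.edgeFinset : Set (Sym2 V)) fun _ => {True} := by
    ext q
    simp only [Set.mem_preimage, Set.mem_ofPred_eq, Set.mem_pi, Finset.mem_coe, mem_edgeFinset,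
      Set.mem_singleton_iff, eq_iff_iff, iff_true]
    constructor
    · intro h e he
      induction e using Sym2.inductionOn with
      | _ a b =>
        have := h he
        simp only [fromEdgeSet_adj] at this
        exact this.1
    · intro h a b hab
      exact (fromEdgeSet_adj _).2 ⟨h s(a, b) hab, hab.ne⟩
  rw [hset, Measure.infinitePi_pi _ (fun _ _ => .of_discrete)]
  rw [Finset.prod_congr rfl (g := fun _ => (toNNReal p : ℝ≥0∞)), Finset.prod_const,
    ← Set.ncard_coe_finset, coe_edgeFinset]
  intro e he
  -- An edge is not a loop, so its coordinate is true with probability `p`.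
  have : ¬ e.IsDiag := H.not_isDiag_of_mem_edgeSet (mem_edgeFinset.mp he)
  simp [this]

/-- The number of labelled copies as a sum of indicators over the potential copies. -/
lemma labelledCopyCount_eq_sum [Fintype V] [Fintype W] (G : SimpleGraph V) (F : SimpleGraph W) :
    (G.labelledCopyCount F : ℝ≥0∞) =
      ∑ f : W ↪ V, {G : SimpleGraph V | F.map f ≤ G}.indicator 1 G := by
  classical
  have : G.labelledCopyCount F = (Finset.univ.filter fun f : W ↪ V => F.map f ≤ G).card := by
    rw [labelledCopyCount, ← Fintype.card_subtype]
    refine Fintype.card_congr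
      ⟨fun f => ⟨f.toEmbedding, (map_le_iff_le_comap _ _ _).2 f.toHom.le_comap⟩,
        fun f => ⟨⟨f.1, fun h => (map_le_iff_le_comap _ _ _).1 f.2 h⟩, f.1.injective⟩,
        fun f => rfl, fun f => rfl⟩
  rw [this, Finset.card_filter]
  push_cast
  simp [Set.indicator_apply]

lemma measurable_labelledCopyCount [Fintype V] [Fintype W] (F : SimpleGraph W) :
    Measurable fun G : SimpleGraph V => (G.labelledCopyCount F : ℝ≥0∞) := by
  simp_rw [labelledCopyCount_eq_sum]
  exact Finset.measurable_sum _ fun f _ => measurable_one.indicator (measurableSet_setOf_le _)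

/-- Linearity of expectation: an embedding preserves the number of edges, and there are at most `|V|
^ |W|` embeddings. -/
lemma lintegral_labelledCopyCount_le [Fintype V] [Fintype W] (p : I) (F : SimpleGraph W) :
    ∫⁻ G, (G.labelledCopyCount F : ℝ≥0∞) ∂binomialRandom V p ≤
      (Fintype.card V : ℝ≥0∞) ^ Fintype.card W * (toNNReal p : ℝ≥0∞) ^ F.edgeSet.ncard := by
  classical
  simp_rw [labelledCopyCount_eq_sum]
  rw [lintegral_finsetSum _ fun f _ => measurable_one.indicator (measurableSet_setOf_le _)]
  simp_rw [lintegral_indicator_one (measurableSet_setOf_le _), binomialRandom_setOf_le]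
  have hmap : ∀ f : W ↪ V, (F.map f).edgeSet.ncard = F.edgeSet.ncard := fun f => by
    rw [edgeSet_map, Set.ncard_image_of_injective _ f.sym2Map.injective]
  simp_rw [hmap]
  rw [Finset.sum_const, nsmul_eq_mul, Finset.card_univ]
  gcongr
  have := Fintype.card_le_of_injective (fun f : W ↪ V => (f : W → V)) DFunLike.coe_injective
  rw [Fintype.card_fun] at this
  exact_mod_cast this

/-- First moment bound for the failure of a coloring with `k` colors. -/
lemma binomialRandom_lt_avoidingColorNumber_le [Fintype V] [Fintype W] (p : I)
    (F : SimpleGraph W) {k : ℕ} (hk : 0 < k) :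
    binomialRandom V p {G | (k : ℕ∞) < G.avoidingColorNumber F} ≤
      (Fintype.card V : ℝ≥0∞) ^ Fintype.card W * (toNNReal p : ℝ≥0∞) ^ F.edgeSet.ncard * k /
        k ^ F.edgeSet.ncard := by
  have hsub : {G : SimpleGraph V | (k : ℕ∞) < G.avoidingColorNumber F} ⊆
      {G | (k : ℝ≥0∞) ^ F.edgeSet.ncard ≤ G.labelledCopyCount F * k} := by
    intro G hG
    by_contra h
    simp only [Set.mem_ofPred_eq, not_le] at h
    obtain ⟨C, hC⟩ := exists_edgeLabeling_free G F hk (by exact_mod_cast h)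
    exact absurd (avoidingColorNumber_le C hC) (not_le.mpr hG)
  have hk0 : (k : ℝ≥0∞) ^ F.edgeSet.ncard ≠ 0 := pow_ne_zero _ (by exact_mod_cast hk.ne')
  have hktop : (k : ℝ≥0∞) ^ F.edgeSet.ncard ≠ ⊤ := ENNReal.pow_ne_top (ENNReal.natCast_ne_top k)
  refine (measure_mono hsub).trans ((meas_ge_le_lintegral_div
    ((measurable_labelledCopyCount F).mul_const _).aemeasurable hk0 hktop).trans ?_)
  rw [lintegral_mul_const _ (measurable_labelledCopyCount F)]
  gcongr
  exact lintegral_labelledCopyCount_le p F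

end Random

end SimpleGraph

/-! ### Numerical bounds -/

/-- Makes the error geometric when `k ≤ 4`: `exp (1 / 4)` pays for `N`, and `3 / 4` bounds `d / k`.
-/
lemma Real.exp_quarter_lt : Real.exp (1 / 4) * (3 / 4) < 1 := by
  have h : Real.exp (1 / 4) ^ 4 = Real.exp 1 := by rw [← Real.exp_nat_mul]; norm_num
  have : Real.exp (1 / 4) < 4 / 3 := by
    refine lt_of_pow_lt_pow_left₀ 4 (by norm_num) ?_
    rw [h]
    linarith [Real.exp_one_lt_d9, (by norm_num : (3 : ℝ) < (4 / 3) ^ 4)]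
  linarith

lemma Real.exp_half_lt : Real.exp (1 / 2) * (3 / 5) < 1 := by
  have h : Real.exp (1 / 2) ^ 2 = Real.exp 1 := by rw [← Real.exp_nat_mul]; norm_num
  have : Real.exp (1 / 2) < 5 / 3 := by
    refine lt_of_pow_lt_pow_left₀ 2 (by norm_num) ?_
    rw [h]
    linarith [Real.exp_one_lt_d9, (by norm_num : (2.7182818286 : ℝ) < (5 / 3) ^ 2)]
  linarith

/-- With `k = ⌊2 d⌋` colors, each color class has expected degree `d / k` bounded away from `1`,
so that the expected number of monochromatic paths is exponentially small. -/
lemma mul_pow_div_floor_le {n N : ℕ} {d : ℝ} (hN : 0 < N) (hd : 1 ≤ d) (hdN : 2 * d ≤ N)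
    (hlog : 4 * Real.log N ≤ n) :
    (N : ℝ) * ⌊2 * d⌋₊ * (d / ⌊2 * d⌋₊) ^ n ≤
      4 * (Real.exp (1 / 4) * (3 / 4)) ^ n + (Real.exp (1 / 2) * (3 / 5)) ^ n := by
  set k := ⌊2 * d⌋₊ with hkdef
  have hk2 : 2 ≤ k := Nat.le_floor (by push_cast; linarith)
  have hk2' : (2 : ℝ) ≤ k := by exact_mod_cast hk2
  have hkle : (k : ℝ) ≤ 2 * d := Nat.floor_le (by linarith)
  have hlt : 2 * d < k + 1 := Nat.lt_floor_add_one _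
  have hN' : (0 : ℝ) < N := by exact_mod_cast hN
  have hNexp : (N : ℝ) ≤ Real.exp (1 / 4) ^ n := by
    rw [← Real.exp_nat_mul, ← Real.log_le_iff_le_exp hN']
    linarith
  have hhalf : Real.exp (1 / 4) ^ n * Real.exp (1 / 4) ^ n = Real.exp (1 / 2) ^ n := by
    rw [← mul_pow, ← Real.exp_add]; norm_num
  -- Since `d < (k + 1) / 2`, the ratio `d / k` is below `1 / 2 + 1 / (2 * k)`: at most `3 / 4` for
  -- `k ≥ 2`, at most `3 / 5` for `k ≥ 5`. Bounding the factor `k` by `N` costs a second `exp (n /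
  -- 4)`, which `3 / 5` absorbs but `3 / 4` does not; hence small `k` is bounded by `4`.
  rcases le_or_gt k 4 with hk | hk
  · have hk' : (k : ℝ) ≤ 4 := by exact_mod_cast hk
    have hq : d / k ≤ 3 / 4 := by
      rw [div_le_iff₀ (by linarith)]; linarith
    calc (N : ℝ) * k * (d / k) ^ n ≤ Real.exp (1 / 4) ^ n * 4 * (3 / 4) ^ n := by gcongr
      _ = 4 * (Real.exp (1 / 4) * (3 / 4)) ^ n := by rw [mul_pow]; ring
      _ ≤ _ := le_add_of_nonneg_right (by positivity)
  · have hk' : (5 : ℝ) ≤ k := by exact_mod_cast hk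
    have hq : d / k ≤ 3 / 5 := by
      rw [div_le_iff₀ (by linarith)]; linarith
    calc (N : ℝ) * k * (d / k) ^ n
        ≤ Real.exp (1 / 4) ^ n * Real.exp (1 / 4) ^ n * (3 / 5) ^ n := by
          gcongr; linarith
      _ = (Real.exp (1 / 2) * (3 / 5)) ^ n := by rw [hhalf, mul_pow]
      _ ≤ _ := le_add_of_nonneg_left (by positivity)

/-- Failure probability of an edge coloring of `G(N, p)` with `⌊2 d⌋` colors that avoids the path
with `n` edges, where `d = N p`. -/
lemma SimpleGraph.one_sub_le_binomialRandom_avoidingColorNumber {n N : ℕ} {p : I} {d : ℝ}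
    (hN : 0 < N) (hd : d = N * p) (hd1 : 1 ≤ d) (hdN : 2 * d ≤ N) (hlog : 4 * Real.log N ≤ n) :
    1 - ENNReal.ofReal
        (4 * (Real.exp (1 / 4) * (3 / 4)) ^ n + (Real.exp (1 / 2) * (3 / 5)) ^ n) ≤
      binomialRandom (Fin N) p
        {G | (G.avoidingColorNumber (pathGraph (n + 1)) : ℝ≥0∞) ≤ ENNReal.ofReal (2 * d)} := by
  set k := ⌊2 * d⌋₊ with hkdef
  have hk : 0 < k := Nat.floor_pos.mpr (by linarith)
  have hk' : (0 : ℝ) < k := by exact_mod_cast hk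
  set μ := binomialRandom (Fin N) p
  have hbad : μ {G | (k : ℕ∞) < G.avoidingColorNumber (pathGraph (n + 1))} ≤ ENNReal.ofReal
      (4 * (Real.exp (1 / 4) * (3 / 4)) ^ n + (Real.exp (1 / 2) * (3 / 5)) ^ n) := by
    refine (binomialRandom_lt_avoidingColorNumber_le p _ hk).trans ?_
    refine le_trans (le_of_eq ?_) (ENNReal.ofReal_le_ofReal (mul_pow_div_floor_le hN hd1 hdN hlog))
    have hp : (toNNReal p : ℝ≥0∞) = ENNReal.ofReal (p : ℝ) := by
      rw [ENNReal.ofReal, Real.toNNReal_of_nonneg p.2.1]; rfl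
    rw [ncard_edgeSet_pathGraph, Fintype.card_fin, Fintype.card_fin, hp,
      ← ENNReal.ofReal_natCast N, ← ENNReal.ofReal_natCast k, ← ENNReal.ofReal_pow (by positivity),
      ← ENNReal.ofReal_pow p.2.1, ← ENNReal.ofReal_pow (by positivity),
      ← ENNReal.ofReal_mul (by positivity),
      ← ENNReal.ofReal_mul (mul_nonneg (by positivity) (pow_nonneg p.2.1 n)),
      ← ENNReal.ofReal_div_of_pos (by positivity), ← hkdef, hd, div_pow, mul_pow, pow_succ]
    congr 1
    ring
  have hsub : {G : SimpleGraph (Fin N) |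
        (G.avoidingColorNumber (pathGraph (n + 1)) : ℝ≥0∞) ≤ ENNReal.ofReal (2 * d)}ᶜ ⊆
      {G | (k : ℕ∞) < G.avoidingColorNumber (pathGraph (n + 1))} := by
    intro G hG
    by_contra h
    refine hG ?_
    have h1 : G.avoidingColorNumber (pathGraph (n + 1)) ≤ (k : ℕ∞) := not_lt.mp h
    calc (G.avoidingColorNumber (pathGraph (n + 1)) : ℝ≥0∞) ≤ ((k : ℕ∞) : ℝ≥0∞) := by
          exact_mod_cast h1
      _ = ENNReal.ofReal k := by simp
      _ ≤ ENNReal.ofReal (2 * d) := ENNReal.ofReal_le_ofReal (Nat.floor_le (by linarith))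
  rw [tsub_le_iff_right]
  calc (1 : ℝ≥0∞) = μ Set.univ := measure_univ.symm
    _ ≤ _ := by
      rw [← Set.union_compl_self {G : SimpleGraph (Fin N) |
        (G.avoidingColorNumber (pathGraph (n + 1)) : ℝ≥0∞) ≤ ENNReal.ofReal (2 * d)}]
      exact (measure_union_le _ _).trans (add_le_add_right ((measure_mono hsub).trans hbad) _)

theorem corollary5p3 (N : ℕ → ℕ) (ω : ℕ → ℝ) (p : ℕ → unitInterval)
    (hN : ∀ᶠ n in Filter.atTop, n < N n)
    (hlog : ∀ᶠ n : ℕ in Filter.atTop, 4 * Real.log (N n) ≤ n)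
    (hω : ∀ᶠ n in Filter.atTop, 2 ≤ ω n)
    (hp : ∀ᶠ n : ℕ in Filter.atTop, (p n : ℝ) = 1 / (ω n * n))
    (hpN : ∀ᶠ n : ℕ in Filter.atTop, 1 / (N n : ℝ) ≤ p n) :
    Filter.Tendsto
      (fun n : ℕ =>
        SimpleGraph.binomialRandom (Fin (N n)) (p n)
          {G | (G.avoidingColorNumber (SimpleGraph.pathGraph (n + 1)) : ENNReal) ≤
            ENNReal.ofReal (2 * ((N n : ℝ) / n) / ω n)})
      Filter.atTop (nhds 1) := by
  have hlim : Tendsto (fun n : ℕ => 1 - ENNReal.ofReal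
      (4 * (Real.exp (1 / 4) * (3 / 4)) ^ n + (Real.exp (1 / 2) * (3 / 5)) ^ n)) atTop (𝓝 1) := by
    have h1 := tendsto_pow_atTop_nhds_zero_of_lt_one (by positivity) Real.exp_quarter_lt
    have h2 := tendsto_pow_atTop_nhds_zero_of_lt_one (by positivity) Real.exp_half_lt
    have h3 := ENNReal.tendsto_ofReal ((h1.const_mul 4).add h2)
    have h4 := ENNReal.Tendsto.sub (tendsto_const_nhds (x := (1 : ℝ≥0∞))) h3
      (.inl ENNReal.one_ne_top)
    simpa using h4
  refine tendsto_of_tendsto_of_tendsto_of_le_of_le' hlim tendsto_const_nhds ?_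
    (Eventually.of_forall fun n => prob_le_one)
  filter_upwards [hN, hlog, hω, hp, hpN, eventually_gt_atTop 0] with n hN hlog hω hp hpN hn
  have hn' : (1 : ℝ) ≤ n := by exact_mod_cast hn
  have hN' : (0 : ℝ) < N n := by exact_mod_cast hn.trans hN
  have hd : 2 * ((N n : ℝ) / n) / ω n = 2 * (N n * p n) := by
    rw [hp]; field_simp
  rw [hd]
  refine SimpleGraph.one_sub_le_binomialRandom_avoidingColorNumber (hn.trans hN) rfl ?_ ?_ hlog
  -- The hypothesis `1 / N ≤ p` is exactly `1 ≤ d`, which gives at least two colors.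
  · rwa [div_le_iff₀' hN'] at hpN
  · have : (p n : ℝ) ≤ 1 / 2 := by
      rw [hp]
      exact one_div_le_one_div_of_le two_pos (by nlinarith)
    nlinarith
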